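/- Let $n\ge 0$, let $K\subset\mathbb{C}^n$ be a compact set and let $\nu$ be a (complex-valued) distribution on $\mathbb{C}^n$ whose support is contained in $K$. Write $dd^c=\frac{i}{\pi}\partial\bar\partial$. Then the following two properties are equivalent: (i) there exists a positive current $T$ of bidimension $(1,1)$ on $\mathbb{C}^n$, with support contained in $K$, such that $dd^cT=\nu$, that is, $\langle T,dd^c\phi\rangle=\langle\nu,\phi\rangle$ for every smooth compactly supported function $\phi$; (ii) for every real-valued smooth function $\phi$ on $\mathbb{C}^n$ such that $dd^c\phi\ge 0$ at every point of $K$, one has $\langle\nu,\phi\rangle\ge 0$ (in particular, $\langle\nu,\phi\rangle$ is real). Here a current of bidimension $(1,1)$ is a continuous linear functional on the space of smooth compactly supported $(1,1)$-forms on $\mathbb{C}^n$; it is positive if its value at every pointwise positive test form is a non-negative real number. A real $(1,1)$-form $\alpha$ is positive at a point, $\alpha\ge 0$, if $\alpha(v,iv)\ge 0$ for every tangent vector $v$ there. Since $\nu$ has compact support, $\langle\nu,\phi\rangle$ is defined for every smooth $\phi$ by $\langle\nu,\phi\rangle:=\langle\nu,\chi\phi\rangle$, where $\chi$ is any smooth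 compactly supported function equal to $1$ in a neighbourhood of $K$. -/

import Mathlib

open scoped ContDiff Distributions ComplexOrder Topology

noncomputable section

/-- The complex vector space `ℂⁿ`. -/
abbrev Cn (n : ℕ) := EuclideanSpace ℂ (Fin n)

/-- The complex structure of `ℂⁿ`, multiplication by `i`, as a real-linear map. -/
def complexJ (n : ℕ) : Cn n →L[ℝ] Cn n :=
  Complex.I • ContinuousLinearMap.id ℝ (Cn n)

@[simp] theorem complexJ_apply (n : ℕ) (v : Cn n) : complexJ n v = Complex.I • v := rfl

/-- The real `(1,1)`-covectors of `ℂⁿ`: the real alternating `2`-forms `α` with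
`α(iu, iv) = α(u, v)`. (The `(1,1)`-part of a `2`-form is its invariant part under multiplication
by `i`, the sum of its `(2,0)`- and `(0,2)`-parts is the anti-invariant part.) -/
def Form11 (n : ℕ) : Submodule ℝ (Cn n [⋀^Fin 2]→L[ℝ] ℝ) where
  carrier := {α | α.compContinuousLinearMap (complexJ n) = α}
  zero_mem' := by ext; simp
  add_mem' := by
    intro α β hα hβ
    ext v
    have h1 := congrArg (fun γ => γ v) hα
    have h2 := congrArg (fun γ => γ v) hβ
    simp only [ContinuousAlternatingMap.compContinuousLinearMap_apply] at h1 h2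
    simp [h1, h2]
  smul_mem' := by
    intro c α hα
    ext v
    have h1 := congrArg (fun γ => γ v) hα
    simp only [ContinuousAlternatingMap.compContinuousLinearMap_apply] at h1
    simp [h1]

theorem mem_Form11_iff {n : ℕ} (α : Cn n [⋀^Fin 2]→L[ℝ] ℝ) :
    α ∈ Form11 n ↔ ∀ u v : Cn n, α ![Complex.I • u, Complex.I • v] = α ![u, v] := by
  constructor
  · intro h u v
    have h1 := congrArg (fun γ => γ ![u, v]) h
    simp only [ContinuousAlternatingMap.compContinuousLinearMap_apply] at h1
    rw [← h1]
    congr 1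
    ext i : 1
    fin_cases i <;> simp
  · intro h
    change α.compContinuousLinearMap (complexJ n) = α
    ext v
    have hv : v = ![v 0, v 1] := by ext i : 1; fin_cases i <;> rfl
    rw [ContinuousAlternatingMap.compContinuousLinearMap_apply]
    conv_rhs => rw [hv, ← h]
    congr 1
    ext i : 1
    fin_cases i <;> simp

/-- A real `2`-covector `α` of type `(1,1)` is positive (`α ≥ 0`) if `α(v, iv) ≥ 0` for all `v`. For
`α = (i/2) ∑ aⱼₖ dzⱼ ∧ dz̄ₖ` this says that the Hermitian matrix `(aⱼₖ)` is positive semidefinite. -/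
def IsPositiveCovector {n : ℕ} (α : Cn n [⋀^Fin 2]→L[ℝ] ℝ) : Prop :=
  ∀ v : Cn n, 0 ≤ α ![v, Complex.I • v]

/-- The real `1`-form `dᶜφ = (i/2π)(∂̄φ - ∂φ)`, that is `dᶜφ(v) = -(1/2π) dφ(iv)`. -/
def dcForm {n : ℕ} (φ : Cn n → ℝ) (z : Cn n) : Cn n [⋀^Fin 1]→L[ℝ] ℝ :=
  ContinuousAlternatingMap.ofSubsingleton ℝ (Cn n) ℝ (0 : Fin 1)
    (-(1 / (2 * Real.pi)) • (fderiv ℝ φ z).comp (complexJ n))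

/-- The real `2`-form `ddᶜφ = (i/π) ∂∂̄φ`, the exterior derivative of `dᶜφ`. -/
def ddcForm {n : ℕ} (φ : Cn n → ℝ) (z : Cn n) : Cn n [⋀^Fin 2]→L[ℝ] ℝ :=
  extDeriv (dcForm φ) z

theorem contDiff_dcForm {n : ℕ} {φ : Cn n → ℝ} (hφ : ContDiff ℝ ∞ φ) :
    ContDiff ℝ ∞ (dcForm φ) := by
  have h1 : ContDiff ℝ ∞ (fderiv ℝ φ) := hφ.fderiv_right (by simp)
  have h2 : ContDiff ℝ ∞ fun z => -(1 / (2 * Real.pi)) • (fderiv ℝ φ z).comp (complexJ n) :=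
    (h1.clm_comp contDiff_const).const_smul _
  exact (ContinuousAlternatingMap.ofSubsingletonLIE (𝕜 := ℝ) (E := Cn n) (F := ℝ)
    (0 : Fin 1)).toContinuousLinearEquiv.contDiff.comp h2

theorem contDiff_ddcForm {n : ℕ} {φ : Cn n → ℝ} (hφ : ContDiff ℝ ∞ φ) :
    ContDiff ℝ ∞ (ddcForm φ) :=
  (ContinuousAlternatingMap.alternatizeUncurryFinCLM ℝ (Cn n) ℝ).contDiff.comp
    ((contDiff_dcForm hφ).fderiv_right (by simp))

/-- The value of `ddᶜφ` in terms of the second real derivative of `φ`. -/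
theorem ddcForm_apply {n : ℕ} {φ : Cn n → ℝ} (hφ : ContDiff ℝ ∞ φ) (z u v : Cn n) :
    ddcForm φ z ![u, v] = -(1 / (2 * Real.pi)) *
      (fderiv ℝ (fderiv ℝ φ) z u (Complex.I • v) - fderiv ℝ (fderiv ℝ φ) z v (Complex.I • u)) := by
  have hd : Differentiable ℝ (fderiv ℝ φ) :=
    (hφ.fderiv_right (m := ∞) (by simp)).differentiable (by simp)
  have key : ∀ w y : Cn n, fderiv ℝ (fun x => dcForm φ x ![w]) z y =
      -(1 / (2 * Real.pi)) * fderiv ℝ (fderiv ℝ φ) z y (Complex.I • w) := by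
    intro w y
    have h : (fun x => dcForm φ x ![w]) =
        fun x => -(1 / (2 * Real.pi)) * fderiv ℝ φ x (Complex.I • w) := by
      funext x
      simp [dcForm]
    have h2 : HasFDerivAt (fun x => -(1 / (2 * Real.pi)) * fderiv ℝ φ x (Complex.I • w))
        (-(1 / (2 * Real.pi)) • (fderiv ℝ (fderiv ℝ φ) z).flip (Complex.I • w)) z := by
      have := ((hd z).hasFDerivAt.clm_apply (hasFDerivAt_const (Complex.I • w) z)).const_mul
        (-(1 / (2 * Real.pi)))
      simpa using this
    rw [h, h2.fderiv]
    simp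
  have e0 : (0 : Fin 2).removeNth ![u, v] = ![v] := by
    ext i : 1; fin_cases i; rfl
  have e1 : (1 : Fin 2).removeNth ![u, v] = ![u] := by
    ext i : 1; fin_cases i; rfl
  rw [ddcForm, extDeriv_apply ((contDiff_dcForm hφ).differentiable (by simp) z)]
  rw [Fin.sum_univ_two, e0, e1, key, key]
  simp
  ring

/-- `ddᶜφ` is a form of type `(1,1)`. -/
theorem ddcForm_mem {n : ℕ} {φ : Cn n → ℝ} (hφ : ContDiff ℝ ∞ φ) (z : Cn n) :
    ddcForm φ z ∈ Form11 n := by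
  have hs : IsSymmSndFDerivAt ℝ φ z :=
    hφ.contDiffAt.isSymmSndFDerivAt (by
      rw [minSmoothness_of_isRCLikeNormedField]
      exact WithTop.coe_le_coe.mpr le_top)
  rw [mem_Form11_iff]
  intro u v
  rw [ddcForm_apply hφ, ddcForm_apply hφ]
  have e : ∀ w : Cn n, Complex.I • Complex.I • w = -w := by
    intro w; rw [smul_smul, Complex.I_mul_I, neg_one_smul]
  rw [e, e, hs.eq (Complex.I • u) (-v), hs.eq (Complex.I • v) (-u)]
  simp
  ring

/-- The projection of a real `2`-covector to its `(1,1)`-part. It is only used to see that `ddᶜφ` is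
smooth as a map into the space of `(1,1)`-covectors. -/
def form11Proj (n : ℕ) : (Cn n [⋀^Fin 2]→L[ℝ] ℝ) →L[ℝ] Form11 n :=
  ContinuousLinearMap.codRestrict ((1 / 2 : ℝ) • (ContinuousLinearMap.id ℝ _ +
    ContinuousAlternatingMap.compContinuousLinearMapCLM (complexJ n))) (Form11 n) (by
      intro α
      change ContinuousAlternatingMap.compContinuousLinearMap _ _ = _
      ext v
      have e : α (fun i => Complex.I • Complex.I • v i) = α v := by
        have := α.map_smul_univ (fun _ => (-1 : ℝ)) v
        simpa [smul_smul] using this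
      simp [Function.comp_def, e]
      ring)

theorem form11Proj_coe {n : ℕ} (α : Form11 n) : form11Proj n α = α := by
  obtain ⟨α, hα⟩ := α
  apply Subtype.ext
  have h : α.compContinuousLinearMap (complexJ n) = α := hα
  change (1 / 2 : ℝ) • (α + α.compContinuousLinearMap (complexJ n)) = α
  rw [h, ← two_smul ℝ α, smul_smul]
  norm_num

/-- For a real test function `φ` on `ℂⁿ`, the test form `ddᶜφ` of bidegree `(1,1)`. -/
def ddcTest {n : ℕ} (φ : 𝓓((⊤ : TopologicalSpace.Opens (Cn n)), ℝ)) :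
    𝓓((⊤ : TopologicalSpace.Opens (Cn n)), Form11 n) where
  toFun z := ⟨ddcForm φ z, ddcForm_mem φ.contDiff z⟩
  contDiff' := by
    have h0 : ContDiff ℝ ∞ fun α => form11Proj n α := by
      apply ContinuousLinearMap.contDiff
    have h := h0.comp (contDiff_ddcForm φ.contDiff)
    have e : (fun z => (⟨ddcForm φ z, ddcForm_mem φ.contDiff z⟩ : Form11 n)) =
        (fun α => form11Proj n α) ∘ ddcForm φ :=
      funext fun z => (form11Proj_coe ⟨ddcForm φ z, ddcForm_mem φ.contDiff z⟩).symm
    rw [e]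
    exact h
  hasCompactSupport' := by
    refine φ.hasCompactSupport.of_isClosed_subset (isClosed_tsupport _)
      (closure_minimal ?_ (isClosed_tsupport _))
    intro z hz
    by_contra hzt
    apply hz
    have h0 : (φ : Cn n → ℝ) =ᶠ[𝓝 z] fun _ => 0 := notMem_tsupport_iff_eventuallyEq.mp hzt
    have h1 : dcForm φ =ᶠ[𝓝 z] fun _ => 0 := by
      filter_upwards [h0.fderiv (𝕜 := ℝ)] with y hy
      simp only [dcForm, hy]
      ext
      simp
    apply Subtype.ext
    change ddcForm φ z = 0
    rw [ddcForm, h1.extDeriv_eq]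
    simp only [extDeriv, fderiv_fun_const, Pi.zero_apply]
    exact map_zero (ContinuousAlternatingMap.alternatizeUncurryFinCLM ℝ (Cn n) ℝ)
  tsupport_subset' := by simp

/-- The currents of bidimension `(1,1)` on `ℂⁿ`: the continuous linear functionals on the space of
compactly supported smooth `(1,1)`-forms. As for the distributions `𝓓'(Ω, ℂ)`, it suffices to
test against real forms: a complex `(1,1)`-form is `α + iβ` with `α` and `β` real, and the value of
the functional at it is `T α + i T β`. -/
abbrev Current11 (n : ℕ) :=
  𝓓((⊤ : TopologicalSpace.Opens (Cn n)), Form11 n) →L[ℝ] ℂ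

/-- A current `T` of bidimension `(1,1)` is positive if `⟨T, α⟩ ≥ 0` (in particular `⟨T, α⟩` is real)
for every test form `α` that is positive at every point. -/
def Current11.IsPositive {n : ℕ} (T : Current11 n) : Prop :=
  ∀ α : 𝓓((⊤ : TopologicalSpace.Opens (Cn n)), Form11 n),
    (∀ z, IsPositiveCovector (α z : Cn n [⋀^Fin 2]→L[ℝ] ℝ)) → 0 ≤ T α

/-- `ddᶜT = ν`, where `⟨ddᶜT, φ⟩ = ⟨T, ddᶜφ⟩` for every test function `φ`. -/
def Current11.DdcEq {n : ℕ} (T : Current11 n)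
    (ν : 𝓓'((⊤ : TopologicalSpace.Opens (Cn n)), ℂ)) : Prop :=
  ∀ φ : 𝓓((⊤ : TopologicalSpace.Opens (Cn n)), ℝ), ν φ = T (ddcTest φ)

/-- The product of a test function with a smooth function. -/
def mulTest {n : ℕ} (χ : 𝓓((⊤ : TopologicalSpace.Opens (Cn n)), ℝ)) (φ : Cn n → ℝ)
    (hφ : ContDiff ℝ ∞ φ) : 𝓓((⊤ : TopologicalSpace.Opens (Cn n)), ℝ) where
  toFun z := χ z * φ z
  contDiff' := χ.contDiff.mul hφ
  hasCompactSupport' := χ.hasCompactSupport.mul_right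
  tsupport_subset' := by simp

/-- Every compact set has a cutoff function: a test function equal to `1` near the set. -/
theorem exists_cutoff {n : ℕ} {K : Set (Cn n)} (hK : IsCompact K) :
    ∃ χ : 𝓓((⊤ : TopologicalSpace.Opens (Cn n)), ℝ), ∀ᶠ z in 𝓝ˢ K, χ z = 1 := by
  obtain ⟨R, hR⟩ := hK.isBounded.subset_ball (0 : Cn n)
  obtain ⟨f, hf1, hf0, -⟩ := exists_contMDiffMap_one_nhds_of_subset_interior
    (n := ⊤) (modelWithCornersSelf ℝ (Cn n)) (s := K) (t := Metric.closedBall (0 : Cn n) R)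
    hK.isClosed (hR.trans Metric.ball_subset_interior_closedBall)
  refine ⟨⟨f, f.contMDiff.contDiff, ?_, by simp⟩, hf1⟩
  exact HasCompactSupport.intro (isCompact_closedBall (0 : Cn n) R) hf0

/-- A distribution vanishes on the complement of any closed set that contains its support. -/
theorem isVanishingOn_compl {n : ℕ} {K : Set (Cn n)}
    {ν : 𝓓'((⊤ : TopologicalSpace.Opens (Cn n)), ℂ)} (hν : Distribution.dsupport ν ⊆ K) :
    Distribution.IsVanishingOn ν Kᶜ := by
  intro u hu
  have hloc : ∀ x : tsupport u, ∃ s : Set (Cn n), IsOpen s ∧ (x : Cn n) ∈ s ∧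
      Distribution.IsVanishingOn ν s := by
    intro x
    have hx : (x : Cn n) ∈ (Distribution.dsupport ν)ᶜ := fun h => hu x.2 (hν h)
    rw [Distribution.dsupport_compl_eq] at hx
    obtain ⟨s, ⟨h1, h2⟩, h3⟩ := hx
    exact ⟨s, h2, h3, h1⟩
  choose U hUo hxU hUν using hloc
  obtain ⟨f, hf⟩ := SmoothPartitionOfUnity.exists_isSubordinate
    (modelWithCornersSelf ℝ (Cn n)) (isClosed_tsupport u) U hUo
    (fun x hx => Set.mem_iUnion.mpr ⟨⟨x, hx⟩, hxU ⟨x, hx⟩⟩)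
  have hfin : {i | (Function.support (f i) ∩ tsupport u).Nonempty}.Finite :=
    f.locallyFinite.finite_nonempty_inter_compact u.hasCompactSupport
  have hsum : u = ∑ i ∈ hfin.toFinset, mulTest u (f i) (f i).contMDiff.contDiff := by
    ext x
    have hev : ∀ S : Finset (tsupport u),
        (∑ i ∈ S, mulTest u (f i) (f i).contMDiff.contDiff :
          𝓓((⊤ : TopologicalSpace.Opens (Cn n)), ℝ)) x = ∑ i ∈ S, u x * f i x := by
      intro S
      induction S using Finset.cons_induction with
      | empty => rfl
      | cons a S ha ih =>
        rw [Finset.sum_cons, Finset.sum_cons, ← ih]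
        rfl
    rw [hev, ← Finset.mul_sum]
    by_cases hx : x ∈ tsupport u
    · have h1 := f.sum_eq_one hx
      rw [finsum_eq_sum_of_support_subset (s := hfin.toFinset) _ ?_] at h1
      · rw [h1, mul_one]
      · intro i hi
        simp only [Set.Finite.coe_toFinset, Set.mem_ofPred_eq]
        exact ⟨x, hi, hx⟩
    · rw [image_eq_zero_of_notMem_tsupport hx, zero_mul]
  rw [hsum, map_sum]
  refine Finset.sum_eq_zero fun i _ => hUν i _ ?_
  exact (closure_mono (Function.support_mul_subset_right _ _)).trans (hf i)

/-- The value `⟨ν, φ⟩` of a distribution `ν` supported by the compact set `K` at an arbitrary smooth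
function `φ`, which need not have compact support: `⟨ν, φ⟩ = ⟨ν, χφ⟩` for any cutoff function `χ`
equal to `1` near `K`. -/
def pairing {n : ℕ} {K : Set (Cn n)} (hK : IsCompact K)
    (ν : 𝓓'((⊤ : TopologicalSpace.Opens (Cn n)), ℂ)) (φ : Cn n → ℝ) (hφ : ContDiff ℝ ∞ φ) : ℂ :=
  ν (mulTest (exists_cutoff hK).choose φ hφ)

/-- The pairing does not depend on the cutoff function. -/
theorem pairing_eq {n : ℕ} {K : Set (Cn n)} (hK : IsCompact K)
    {ν : 𝓓'((⊤ : TopologicalSpace.Opens (Cn n)), ℂ)} (hν : Distribution.dsupport ν ⊆ K)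
    (φ : Cn n → ℝ) (hφ : ContDiff ℝ ∞ φ) (χ : 𝓓((⊤ : TopologicalSpace.Opens (Cn n)), ℝ))
    (hχ : ∀ᶠ z in 𝓝ˢ K, χ z = 1) : pairing hK ν φ hφ = ν (mulTest χ φ hφ) := by
  rw [pairing, ← sub_eq_zero, ← map_sub]
  apply isVanishingOn_compl hν
  intro z hz hzK
  have h1 := (eventually_nhdsSet_iff_forall.mp (exists_cutoff hK).choose_spec) z hzK
  have h2 := (eventually_nhdsSet_iff_forall.mp hχ) z hzK
  refine (notMem_tsupport_iff_eventuallyEq.mpr ?_) hz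
  filter_upwards [h1, h2] with y hy1 hy2
  change (exists_cutoff hK).choose y * φ y - χ y * φ y = 0
  rw [hy1, hy2, sub_self]

end

/-!
A positive current is of order zero, so that a positive current `T` with support in `K` is
nonnegative at every test form that is positive on `K` only: adding `ε` times the Kähler form makes
the form positive near `K`, a cutoff makes it positive everywhere without changing the value of `T`,
and `ε` tends to `0` (`Current11.IsPositive.nonneg_of_nonneg_on`). Applied to `ddᶜ(χφ)`, this gives
one implication.

For the converse, `ddᶜφ ↦ ⟨ν, φ⟩` is a functional on the subspace of `ddᶜ`-exact test forms, and it
is nonnegative on the cone of the forms that are positive on `K`. This subspace contains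
`ddᶜ(χ‖z‖²)`, a positive multiple of the Kähler form on `K`, which is an order unit for the cone
(`add_smul_kaehler_mem`). The extension theorem of M. Riesz therefore extends the functional to all
test forms, with nonnegative values on the cone (`exists_nonneg_on_factor`). The order unit bounds
such an extension by the supremum norm, hence it is continuous (`continuous_of_nonneg_on`). It
vanishes at forms that vanish on `K`, and so is a positive current with support in `K`
(`exists_current_of_nonneg_on`). The same order unit shows that `⟨ν, φ⟩` is real
(`im_eq_zero_of_nonneg_on`), so nothing is lost by extending its real part.
-/

/-! ### Cutting off test functions -/

/-- The product of a vector-valued test function with a smooth real function. -/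
noncomputable def smulTest {n : ℕ} {F : Type*} [NormedAddCommGroup F] [NormedSpace ℝ F]
    (g : Cn n → ℝ) (hg : ContDiff ℝ ∞ g) (u : 𝓓((⊤ : TopologicalSpace.Opens (Cn n)), F)) :
    𝓓((⊤ : TopologicalSpace.Opens (Cn n)), F) where
  toFun z := g z • u z
  contDiff' := hg.smul u.contDiff
  hasCompactSupport' := u.hasCompactSupport.smul_left
  tsupport_subset' := by simp

theorem smulTest_apply {n : ℕ} {F : Type*} [NormedAddCommGroup F] [NormedSpace ℝ F]
    (g : Cn n → ℝ) (hg : ContDiff ℝ ∞ g) (u : 𝓓((⊤ : TopologicalSpace.Opens (Cn n)), F))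
    (z : Cn n) : smulTest g hg u z = g z • u z := rfl

/-- A continuous functional on vector-valued test functions vanishes on the complement of any set
that contains its support. -/
theorem isVanishingOn_compl_of_dsupport_subset {n : ℕ} {F : Type*} [NormedAddCommGroup F]
    [NormedSpace ℝ F] {K : Set (Cn n)} {T : 𝓓((⊤ : TopologicalSpace.Opens (Cn n)), F) →L[ℝ] ℂ}
    (hT : Distribution.dsupport T ⊆ K) : Distribution.IsVanishingOn T Kᶜ := by
  intro u hu
  have hloc : ∀ x : tsupport u, ∃ s : Set (Cn n), IsOpen s ∧ (x : Cn n) ∈ s ∧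
      Distribution.IsVanishingOn T s := by
    intro x
    have hx : (x : Cn n) ∉ Distribution.dsupport T := fun h => hu x.2 (hT h)
    obtain ⟨s, h1, h2, h3⟩ := (Distribution.notMem_dsupport_iff _).mp hx
    exact ⟨s, h2, h3, h1⟩
  choose U hUo hxU hUT using hloc
  obtain ⟨f, hf⟩ := SmoothPartitionOfUnity.exists_isSubordinate
    (modelWithCornersSelf ℝ (Cn n)) (isClosed_tsupport u) U hUo
    (fun x hx => Set.mem_iUnion.mpr ⟨⟨x, hx⟩, hxU ⟨x, hx⟩⟩)
  have hfin : {i | (Function.support (f i) ∩ tsupport u).Nonempty}.Finite :=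
    f.locallyFinite.finite_nonempty_inter_compact u.hasCompactSupport
  have hsum : u = ∑ i ∈ hfin.toFinset, smulTest (f i) (f i).contMDiff.contDiff u := by
    ext x
    have hev : ∀ S : Finset (tsupport u),
        (∑ i ∈ S, smulTest (f i) (f i).contMDiff.contDiff u :
          𝓓((⊤ : TopologicalSpace.Opens (Cn n)), F)) x = ∑ i ∈ S, f i x • u x := by
      intro S
      induction S using Finset.cons_induction with
      | empty => rfl
      | cons a S ha ih =>
        rw [Finset.sum_cons, Finset.sum_cons, ← ih]
        rfl
    rw [hev, ← Finset.sum_smul]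
    by_cases hx : x ∈ tsupport u
    · have h1 := f.sum_eq_one hx
      rw [finsum_eq_sum_of_support_subset (s := hfin.toFinset) _ ?_] at h1
      · rw [h1, one_smul]
      · intro i hi
        simp only [Set.Finite.coe_toFinset, Set.mem_ofPred_eq]
        exact ⟨x, hi, hx⟩
    · rw [image_eq_zero_of_notMem_tsupport hx, smul_zero]
  rw [hsum, map_sum]
  refine Finset.sum_eq_zero fun i _ => hUT i _ ?_
  exact (closure_mono (Function.support_smul_subset_left _ _)).trans (hf i)

/-- The value of a functional at a test function depends only on the germ of the test function along
any set that contains the support of the functional. -/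
theorem map_eq_of_eventuallyEq_nhdsSet {n : ℕ} {F : Type*} [NormedAddCommGroup F]
    [NormedSpace ℝ F] {K : Set (Cn n)} {T : 𝓓((⊤ : TopologicalSpace.Opens (Cn n)), F) →L[ℝ] ℂ}
    (hT : Distribution.dsupport T ⊆ K) {u v : 𝓓((⊤ : TopologicalSpace.Opens (Cn n)), F)}
    (huv : ∀ᶠ z in 𝓝ˢ K, u z = v z) : T u = T v := by
  rw [← sub_eq_zero, ← map_sub]
  apply isVanishingOn_compl_of_dsupport_subset hT
  intro z hz hzK
  refine (notMem_tsupport_iff_eventuallyEq.mpr ?_) hz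
  filter_upwards [eventually_nhdsSet_iff_forall.mp huv z hzK] with y hy
  change u y - v y = 0
  rw [hy, sub_self]

/-! ### Linearity and locality of `ddᶜ` -/

theorem ddcForm_congr {n : ℕ} {φ ψ : Cn n → ℝ} {z : Cn n} (h : φ =ᶠ[𝓝 z] ψ) :
    ddcForm φ z = ddcForm ψ z := by
  have h1 : dcForm φ =ᶠ[𝓝 z] dcForm ψ := by
    filter_upwards [h.fderiv (𝕜 := ℝ)] with y hy
    simp only [dcForm, hy]
  rw [ddcForm, h1.extDeriv_eq, ddcForm]

theorem ddcForm_add {n : ℕ} {φ ψ : Cn n → ℝ} (hφ : ContDiff ℝ ∞ φ) (hψ : ContDiff ℝ ∞ ψ)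
    (z : Cn n) : ddcForm (φ + ψ) z = ddcForm φ z + ddcForm ψ z := by
  have h : dcForm (φ + ψ) = dcForm φ + dcForm ψ := by
    ext y v
    simp only [dcForm, Pi.add_apply]
    rw [fderiv_add (hφ.differentiable (by simp) y) (hψ.differentiable (by simp) y)]
    simp
  rw [ddcForm, h, extDeriv_add ((contDiff_dcForm hφ).differentiable (by simp) z)
    ((contDiff_dcForm hψ).differentiable (by simp) z)]
  rfl

theorem ddcForm_const_smul {n : ℕ} (c : ℝ) {φ : Cn n → ℝ} (hφ : ContDiff ℝ ∞ φ)
    (z : Cn n) : ddcForm (c • φ) z = c • ddcForm φ z := by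
  have h : dcForm (c • φ) = c • dcForm φ := by
    ext y v
    simp only [dcForm, Pi.smul_apply]
    rw [fderiv_const_smul (hφ.differentiable (by simp) y)]
    simp [mul_left_comm]
  rw [ddcForm, h, extDeriv_smul]
  rfl

/-- The operator `ddᶜ` from real test functions to test forms, as a linear map. -/
noncomputable def ddcLinearMap (n : ℕ) : 𝓓((⊤ : TopologicalSpace.Opens (Cn n)), ℝ) →ₗ[ℝ]
    𝓓((⊤ : TopologicalSpace.Opens (Cn n)), Form11 n) where
  toFun := ddcTest
  map_add' φ ψ := by
    ext1 z
    exact Subtype.ext (ddcForm_add φ.contDiff ψ.contDiff z)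
  map_smul' c φ := by
    ext1 z
    exact Subtype.ext (ddcForm_const_smul c φ.contDiff z)

@[simp] theorem ddcLinearMap_apply {n : ℕ} (φ : 𝓓((⊤ : TopologicalSpace.Opens (Cn n)), ℝ)) :
    ddcLinearMap n φ = ddcTest φ := rfl

/-! ### The standard Kähler form -/

/-- `ddᶜ‖z‖²` is `2 / π` times the standard Kähler form, whose value at `(v, iv)` is `‖v‖²`. -/
theorem ddcForm_norm_sq {n : ℕ} (z v : Cn n) :
    ddcForm (fun x : Cn n => ‖x‖ ^ 2) z ![v, Complex.I • v] = 2 / Real.pi * ‖v‖ ^ 2 := by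
  have h1 : fderiv ℝ (fun x : Cn n => ‖x‖ ^ 2) = fun x => (2 : ℝ) • innerSL ℝ x := by
    ext x v
    simp [fderiv_norm_sq_apply]
  have h2 : fderiv ℝ (fderiv ℝ (fun x : Cn n => ‖x‖ ^ 2)) z = (2 : ℝ) • innerSL ℝ := by
    rw [h1]
    exact ((2 : ℝ) • innerSL ℝ (E := Cn n)).fderiv
  have h3 : Complex.I • Complex.I • v = -v := by
    rw [smul_smul, Complex.I_mul_I, neg_one_smul]
  rw [ddcForm_apply (contDiff_norm_sq ℝ), h2, h3]
  have h4 : innerSL ℝ v v = ‖v‖ ^ 2 := real_inner_self_eq_norm_sq v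
  have h5 : innerSL ℝ (Complex.I • v) (Complex.I • v) = ‖v‖ ^ 2 := by
    refine (real_inner_self_eq_norm_sq (Complex.I • v)).trans ?_
    rw [norm_smul, Complex.norm_I, one_mul]
  simp only [smul_apply, map_neg, h4, h5, smul_eq_mul]
  field_simp
  ring

theorem abs_apply_I_smul_le {n : ℕ} (α : Cn n [⋀^Fin 2]→L[ℝ] ℝ) (v : Cn n) :
    |α ![v, Complex.I • v]| ≤ ‖α‖ * ‖v‖ ^ 2 := by
  have h := α.le_opNorm ![v, Complex.I • v]
  simpa [Fin.prod_univ_two, norm_smul, sq] using h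

/-- The standard Kähler form, up to the factor `2 / π`, is on a given compact set the `ddᶜ` of a test
function, namely of `‖z‖²` cut off. -/
theorem exists_test_kaehler {n : ℕ} {K : Set (Cn n)} (hK : IsCompact K) :
    ∃ ρ : 𝓓((⊤ : TopologicalSpace.Opens (Cn n)), ℝ), ∀ z ∈ K, ∀ v : Cn n,
      (ddcTest ρ z : Cn n [⋀^Fin 2]→L[ℝ] ℝ) ![v, Complex.I • v] = 2 / Real.pi * ‖v‖ ^ 2 := by
  obtain ⟨χ, hχ⟩ := exists_cutoff hK
  refine ⟨mulTest χ (fun x => ‖x‖ ^ 2) (contDiff_norm_sq ℝ), fun z hz v => ?_⟩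
  rw [← ddcForm_norm_sq z v]
  change ddcForm _ z _ = _
  rw [ddcForm_congr]
  filter_upwards [eventually_nhdsSet_iff_forall.mp hχ z hz] with y hy
  change χ y * ‖y‖ ^ 2 = ‖y‖ ^ 2
  rw [hy, one_mul]

/-! ### Positive currents with compact support -/

/-- A covector that is strictly positive at a point stays positive nearby. -/
theorem eventually_isPositiveCovector {n : ℕ} {β : Cn n → Form11 n} {z : Cn n}
    (hβ : ContinuousAt β z) {c : ℝ} (hc : 0 < c)
    (h : ∀ v : Cn n, c * ‖v‖ ^ 2 ≤ (β z : Cn n [⋀^Fin 2]→L[ℝ] ℝ) ![v, Complex.I • v]) :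
    ∀ᶠ y in 𝓝 z, IsPositiveCovector (β y : Cn n [⋀^Fin 2]→L[ℝ] ℝ) := by
  filter_upwards [Metric.continuousAt_iff'.mp hβ c hc] with y hy v
  replace hy : ‖β y - β z‖ < c := (dist_eq_norm (β y) (β z)).symm.trans_lt hy
  have h1 := abs_apply_I_smul_le ((β y - β z : Form11 n) : Cn n [⋀^Fin 2]→L[ℝ] ℝ) v
  have h2 : ‖((β y - β z : Form11 n) : Cn n [⋀^Fin 2]→L[ℝ] ℝ)‖ * ‖v‖ ^ 2 ≤ c * ‖v‖ ^ 2 :=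
    mul_le_mul_of_nonneg_right hy.le (sq_nonneg _)
  have h3 : ((β y - β z : Form11 n) : Cn n [⋀^Fin 2]→L[ℝ] ℝ) ![v, Complex.I • v] =
      (β y : Cn n [⋀^Fin 2]→L[ℝ] ℝ) ![v, Complex.I • v] -
        (β z : Cn n [⋀^Fin 2]→L[ℝ] ℝ) ![v, Complex.I • v] := rfl
  have h4 := neg_abs_le (((β y - β z : Form11 n) : Cn n [⋀^Fin 2]→L[ℝ] ℝ) ![v, Complex.I • v])
  have h5 := h v
  linarith

/-- A positive current with support in the compact set `K` is nonnegative at test forms that are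
positive on `K` only. The form need not be positive near `K`, so it is perturbed by a small multiple
of the Kähler form, which makes it positive on a neighbourhood of `K`. -/
theorem Current11.IsPositive.nonneg_of_nonneg_on {n : ℕ} {K : Set (Cn n)} (hK : IsCompact K)
    {T : Current11 n} (hT : T.IsPositive) (hTK : Distribution.dsupport T ⊆ K)
    (α : 𝓓((⊤ : TopologicalSpace.Opens (Cn n)), Form11 n))
    (hα : ∀ z ∈ K, IsPositiveCovector (α z : Cn n [⋀^Fin 2]→L[ℝ] ℝ)) : 0 ≤ T α := by
  obtain ⟨ρ, hρ⟩ := exists_test_kaehler hK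
  have key : ∀ ε : ℝ, 0 < ε → 0 ≤ T α + ε • T (ddcTest ρ) := by
    intro ε hε
    rw [← map_smul, ← map_add]
    set β := α + ε • ddcTest ρ
    have hpos : ∀ᶠ z in 𝓝ˢ K, IsPositiveCovector (β z : Cn n [⋀^Fin 2]→L[ℝ] ℝ) := by
      refine eventually_nhdsSet_iff_forall.mpr fun z hz => ?_
      refine eventually_isPositiveCovector β.continuous.continuousAt
        (c := ε * (2 / Real.pi)) (by positivity) fun v => ?_
      have h1 : (β z : Cn n [⋀^Fin 2]→L[ℝ] ℝ) ![v, Complex.I • v] =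
        (α z : Cn n [⋀^Fin 2]→L[ℝ] ℝ) ![v, Complex.I • v] +
        ε * (ddcTest ρ z : Cn n [⋀^Fin 2]→L[ℝ] ℝ) ![v, Complex.I • v] := rfl
      have h2 := hα z hz v
      rw [h1, hρ z hz]
      linarith
    obtain ⟨g, hg1, hg0, hg⟩ := exists_contMDiffMap_one_nhds_of_subset_interior
      (n := ⊤) (modelWithCornersSelf ℝ (Cn n)) (s := K)
      (t := {z | IsPositiveCovector (β z : Cn n [⋀^Fin 2]→L[ℝ] ℝ)})
      hK.isClosed (subset_interior_iff_mem_nhdsSet.mpr hpos)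
    have h1 : T (smulTest g g.contMDiff.contDiff β) = T β := by
      refine map_eq_of_eventuallyEq_nhdsSet hTK ?_
      filter_upwards [hg1] with z hz
      rw [smulTest_apply, hz, one_smul]
    rw [← h1]
    refine hT _ fun z v => ?_
    change 0 ≤ g z * (β z : Cn n [⋀^Fin 2]→L[ℝ] ℝ) ![v, Complex.I • v]
    by_cases hz : IsPositiveCovector (β z : Cn n [⋀^Fin 2]→L[ℝ] ℝ)
    · exact mul_nonneg (hg z).1 (hz v)
    · rw [hg0 z hz, zero_mul]
  have hlim : Filter.Tendsto (fun ε : ℝ => T α + ε • T (ddcTest ρ)) (𝓝[>] 0) (𝓝 (T α)) := by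
    have h : Continuous fun ε : ℝ => T α + ε • T (ddcTest ρ) := by fun_prop
    simpa using (h.tendsto 0).mono_left nhdsWithin_le_nhds
  exact ge_of_tendsto hlim (Filter.eventually_of_mem self_mem_nhdsWithin key)

/-! ### Extending functionals by the order structure -/

/-- M. Riesz extension along a linear map `D` that need not be injective: a functional `l` that is
nonnegative on the preimage of a cone factors through `D` by a functional that is nonnegative on the
cone, provided that the range of `D` is cofinal. -/
theorem exists_nonneg_extension_comp {V E : Type*} [AddCommGroup V] [Module ℝ V] [AddCommGroup E]
    [Module ℝ E] (s : PointedCone ℝ E) (D : V →ₗ[ℝ] E) (l : V →ₗ[ℝ] ℝ)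
    (hl : ∀ v, D v ∈ s → 0 ≤ l v) (hD : ∀ y, ∃ v, D v + y ∈ s) :
    ∃ g : E →ₗ[ℝ] ℝ, (∀ v, g (D v) = l v) ∧ ∀ y ∈ s, 0 ≤ g y := by
  obtain ⟨t, ht⟩ := D.rangeRestrict.exists_rightInverse_of_surjective
    (LinearMap.range_rangeRestrict _)
  have ht' : ∀ x, D (t x) = x := fun x => congrArg Subtype.val (LinearMap.congr_fun ht x)
  obtain ⟨g, hgl, hg⟩ := riesz_extension s ⟨LinearMap.range D, l.comp t⟩
    (fun x hx => hl _ (by rwa [ht'])) (fun y => by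
      obtain ⟨v, hv⟩ := hD y
      exact ⟨⟨D v, v, rfl⟩, hv⟩)
  refine ⟨g, fun v => ?_, hg⟩
  -- The cone contains `0`, so `l` vanishes on the kernel of `D` and does not see the choice of `t`.
  have hker : ∀ w, D w = 0 → l w = 0 := by
    intro w hw
    have h1 := hl w (hw ▸ zero_mem s)
    have h2 := hl (-w) (by rw [map_neg, hw, neg_zero]; exact zero_mem s)
    rw [map_neg] at h2
    linarith
  have h1 : g (D v) = l (t ⟨D v, v, rfl⟩) := hgl ⟨D v, v, rfl⟩
  rw [h1, ← sub_eq_zero, ← map_sub]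
  apply hker
  rw [map_sub, ht', sub_self]

/-- The convex cone of test forms that are positive at every point of `K`. -/
def nonnegOnCone {n : ℕ} (K : Set (Cn n)) :
    PointedCone ℝ 𝓓((⊤ : TopologicalSpace.Opens (Cn n)), Form11 n) where
  carrier := {α | ∀ z ∈ K, IsPositiveCovector (α z : Cn n [⋀^Fin 2]→L[ℝ] ℝ)}
  zero_mem' := fun _ _ _ => le_rfl
  add_mem' := fun hα hβ z hz v => add_nonneg (hα z hz v) (hβ z hz v)
  smul_mem' := fun c _ hα z hz v => mul_nonneg c.2 (hα z hz v)

/-- The Kähler form is an order unit for the cone of forms that are positive on `K`. -/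
theorem add_smul_kaehler_mem {n : ℕ} {K : Set (Cn n)}
    {ρ : 𝓓((⊤ : TopologicalSpace.Opens (Cn n)), ℝ)}
    (hρ : ∀ z ∈ K, ∀ v : Cn n,
      (ddcTest ρ z : Cn n [⋀^Fin 2]→L[ℝ] ℝ) ![v, Complex.I • v] = 2 / Real.pi * ‖v‖ ^ 2)
    (α : 𝓓((⊤ : TopologicalSpace.Opens (Cn n)), Form11 n)) {C : ℝ} (hC : ∀ z ∈ K, ‖α z‖ ≤ C) :
    α + (Real.pi / 2 * C) • ddcTest ρ ∈ nonnegOnCone K := by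
  intro z hz v
  have h1 := abs_apply_I_smul_le (α z : Cn n [⋀^Fin 2]→L[ℝ] ℝ) v
  have h2 : ‖(α z : Cn n [⋀^Fin 2]→L[ℝ] ℝ)‖ * ‖v‖ ^ 2 ≤ C * ‖v‖ ^ 2 :=
    mul_le_mul_of_nonneg_right (hC z hz) (sq_nonneg _)
  have h3 := neg_abs_le ((α z : Cn n [⋀^Fin 2]→L[ℝ] ℝ) ![v, Complex.I • v])
  change 0 ≤ (α z : Cn n [⋀^Fin 2]→L[ℝ] ℝ) ![v, Complex.I • v] +
    (Real.pi / 2 * C) * (ddcTest ρ z : Cn n [⋀^Fin 2]→L[ℝ] ℝ) ![v, Complex.I • v]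
  rw [hρ z hz]
  have h4 : Real.pi / 2 * C * (2 / Real.pi * ‖v‖ ^ 2) = C * ‖v‖ ^ 2 := by
    field_simp
  linarith

theorem norm_apply_le_norm_toBoundedContinuousFunction {n : ℕ}
    (α : 𝓓((⊤ : TopologicalSpace.Opens (Cn n)), Form11 n)) (z : Cn n) :
    ‖α z‖ ≤ ‖TestFunction.toBoundedContinuousFunctionCLM ℝ α‖ :=
  (TestFunction.toBoundedContinuousFunctionCLM ℝ α).norm_coe_le_norm z

/-- A linear functional that is nonnegative at the test forms positive on `K` is bounded by the
supremum norm, hence continuous. -/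
theorem continuous_of_nonneg_on {n : ℕ} {K : Set (Cn n)} (hK : IsCompact K)
    (g : 𝓓((⊤ : TopologicalSpace.Opens (Cn n)), Form11 n) →ₗ[ℝ] ℝ)
    (hg : ∀ α ∈ nonnegOnCone K, 0 ≤ g α) : Continuous g := by
  obtain ⟨ρ, hρ⟩ := exists_test_kaehler hK
  have hle : ∀ α, ‖g α‖ ≤
      Real.pi / 2 * ‖TestFunction.toBoundedContinuousFunctionCLM ℝ α‖ * g (ddcTest ρ) := by
    intro α
    have h1 := hg _ (add_smul_kaehler_mem hρ α
      fun z _ => norm_apply_le_norm_toBoundedContinuousFunction α z)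
    have h2 := hg _ (add_smul_kaehler_mem hρ (-α)
      fun z _ => norm_apply_le_norm_toBoundedContinuousFunction (-α) z)
    rw [map_add, map_smul, smul_eq_mul] at h1 h2
    rw [map_neg, map_neg, norm_neg] at h2
    rw [Real.norm_eq_abs, abs_le]
    constructor <;> linarith
  refine continuous_of_continuousAt_zero g ?_
  rw [ContinuousAt, map_zero]
  refine squeeze_zero_norm hle ?_
  have h : Continuous fun α : 𝓓((⊤ : TopologicalSpace.Opens (Cn n)), Form11 n) =>
      Real.pi / 2 * ‖TestFunction.toBoundedContinuousFunctionCLM ℝ α‖ * g (ddcTest ρ) :=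
    (continuous_const.mul (TestFunction.toBoundedContinuousFunctionCLM ℝ).continuous.norm).mul
      continuous_const
  have h0 := h.tendsto 0
  rwa [map_zero, norm_zero, mul_zero, zero_mul] at h0

/-- A linear functional on test functions that is nonnegative wherever `ddᶜφ ≥ 0` on `K` factors
through `ddᶜ` by a functional that is nonnegative at all test forms positive on `K`. -/
theorem exists_nonneg_on_factor {n : ℕ} {K : Set (Cn n)} (hK : IsCompact K)
    (l : 𝓓((⊤ : TopologicalSpace.Opens (Cn n)), ℝ) →ₗ[ℝ] ℝ)
    (hl : ∀ φ, ddcTest φ ∈ nonnegOnCone K → 0 ≤ l φ) :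
    ∃ g : 𝓓((⊤ : TopologicalSpace.Opens (Cn n)), Form11 n) →ₗ[ℝ] ℝ,
      (∀ φ, g (ddcTest φ) = l φ) ∧ ∀ α ∈ nonnegOnCone K, 0 ≤ g α := by
  obtain ⟨ρ, hρ⟩ := exists_test_kaehler hK
  refine exists_nonneg_extension_comp (nonnegOnCone K) (ddcLinearMap n) l hl fun α =>
    ⟨(Real.pi / 2 * ‖TestFunction.toBoundedContinuousFunctionCLM ℝ α‖) • ρ, ?_⟩
  have h := add_smul_kaehler_mem hρ α
    fun z _ => norm_apply_le_norm_toBoundedContinuousFunction α z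
  rwa [add_comm, ← ddcLinearMap_apply, ← map_smul] at h

/-- A functional that is nonnegative at the test forms positive on `K` is a positive current with
support in `K`. -/
theorem exists_current_of_nonneg_on {n : ℕ} {K : Set (Cn n)} (hK : IsCompact K)
    (g : 𝓓((⊤ : TopologicalSpace.Opens (Cn n)), Form11 n) →ₗ[ℝ] ℝ)
    (hg : ∀ α ∈ nonnegOnCone K, 0 ≤ g α) :
    ∃ T : Current11 n, T.IsPositive ∧ Distribution.dsupport T ⊆ K ∧ ∀ α, T α = (g α : ℂ) := by
  refine ⟨Complex.ofRealCLM.comp ⟨g, continuous_of_nonneg_on hK g hg⟩, ?_, ?_, fun _ => rfl⟩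
  · intro α hα
    exact Complex.zero_le_real.mpr (hg α fun z _ => hα z)
  · intro x hx
    refine (Distribution.mem_dsupport_iff x).mp hx K ?_ hK.isClosed
    intro α hα
    have h0 : ∀ z ∈ K, α z = 0 := fun z hz =>
      image_eq_zero_of_notMem_tsupport fun h => hα h hz
    have h1 := hg α fun z hz v => by rw [h0 z hz]; exact le_rfl
    have h2 := hg (-α) fun z hz v => by
      change 0 ≤ -((α z : Cn n [⋀^Fin 2]→L[ℝ] ℝ) ![v, Complex.I • v])
      rw [h0 z hz]
      exact neg_zero.ge
    rw [map_neg] at h2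
    change ((g α : ℝ) : ℂ) = 0
    rw [le_antisymm (by linarith) h1, Complex.ofReal_zero]

/-! ### The duality -/

theorem pairing_test {n : ℕ} {K : Set (Cn n)} (hK : IsCompact K)
    {ν : 𝓓'((⊤ : TopologicalSpace.Opens (Cn n)), ℂ)} (hν : Distribution.dsupport ν ⊆ K)
    (φ : 𝓓((⊤ : TopologicalSpace.Opens (Cn n)), ℝ)) : pairing hK ν φ φ.contDiff = ν φ := by
  obtain ⟨χ, hχ⟩ := exists_cutoff hK
  rw [pairing_eq hK hν φ φ.contDiff χ hχ, ← sub_eq_zero, ← map_sub]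
  apply isVanishingOn_compl hν
  intro z hz hzK
  refine (notMem_tsupport_iff_eventuallyEq.mpr ?_) hz
  filter_upwards [eventually_nhdsSet_iff_forall.mp hχ z hzK] with y hy
  change χ y * φ y - φ y = 0
  rw [hy, one_mul, sub_self]

/-- A functional that is nonnegative at the test functions with `ddᶜφ ≥ 0` on `K` takes real values,
since every test function becomes one of these when a multiple of `‖z‖²` is added. -/
theorem im_eq_zero_of_nonneg_on {n : ℕ} {K : Set (Cn n)} (hK : IsCompact K)
    {ν : 𝓓'((⊤ : TopologicalSpace.Opens (Cn n)), ℂ)}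
    (h : ∀ φ, ddcTest φ ∈ nonnegOnCone K → 0 ≤ ν φ)
    (φ : 𝓓((⊤ : TopologicalSpace.Opens (Cn n)), ℝ)) : (ν φ).im = 0 := by
  obtain ⟨ρ, hρ⟩ := exists_test_kaehler hK
  have h1 : 0 ≤ ν ρ := h ρ fun z hz v => by rw [hρ z hz]; positivity
  have h2 := add_smul_kaehler_mem hρ (ddcTest φ)
    fun z _ => norm_apply_le_norm_toBoundedContinuousFunction (ddcTest φ) z
  rw [← ddcLinearMap_apply, ← ddcLinearMap_apply, ← map_smul, ← map_add] at h2
  have h3 := h _ h2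
  rw [map_add, map_smul, Complex.nonneg_iff] at h3
  rw [Complex.nonneg_iff] at h1
  simpa [← h1.2] using h3.2.symm

theorem proposition3p4 (n : ℕ) (K : Set (Cn n)) (hK : IsCompact K)
    (ν : 𝓓'((⊤ : TopologicalSpace.Opens (Cn n)), ℂ))
    (hν : Distribution.dsupport ν ⊆ K) :
    (∃ T : Current11 n, T.IsPositive ∧ Distribution.dsupport T ⊆ K ∧ T.DdcEq ν) ↔
      ∀ (φ : Cn n → ℝ) (hφ : ContDiff ℝ ∞ φ),
        (∀ z ∈ K, IsPositiveCovector (ddcForm φ z)) → 0 ≤ pairing hK ν φ hφ := by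
  constructor
  · rintro ⟨T, hT, hTK, hTν⟩ φ hφ hpos
    obtain ⟨χ, hχ⟩ := exists_cutoff hK
    rw [pairing_eq hK hν φ hφ χ hχ, hTν]
    refine hT.nonneg_of_nonneg_on hK hTK _ fun z hz => ?_
    have h : ddcForm (mulTest χ φ hφ) z = ddcForm φ z := by
      apply ddcForm_congr
      filter_upwards [eventually_nhdsSet_iff_forall.mp hχ z hz] with y hy
      change χ y * φ y = φ y
      rw [hy, one_mul]
    change IsPositiveCovector (ddcForm (mulTest χ φ hφ) z)
    rw [h]
    exact hpos z hz
  · intro h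
    have hnn : ∀ φ, ddcTest φ ∈ nonnegOnCone K → 0 ≤ ν φ := fun φ hφ => by
      rw [← pairing_test hK hν φ]
      exact h φ φ.contDiff hφ
    obtain ⟨g, hgν, hg⟩ := exists_nonneg_on_factor hK
      (Complex.reLm.comp (ν : 𝓓((⊤ : TopologicalSpace.Opens (Cn n)), ℝ) →ₗ[ℝ] ℂ))
      (fun φ hφ => (Complex.nonneg_iff.mp (hnn φ hφ)).1)
    obtain ⟨T, hT, hTK, hTg⟩ := exists_current_of_nonneg_on hK g hg
    refine ⟨T, hT, hTK, fun φ => ?_⟩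
    rw [hTg, hgν]
    exact Complex.ext rfl (im_eq_zero_of_nonneg_on hK hnn φ)
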